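/- Fix integers $K\ge 1$ and $T\ge 1$. A block of $N$ memory cells has a state in $\{0,\dots,K-1\}^N$; after an erase all cells are at level $K-1$, and the block is then used for $T$ rounds without a further erase. A code on $N$ cells consists, for each round $t=1,\dots,T$, of a nonempty finite message set $\mathcal M_t$, an encoder $f_t:\mathcal M_t\times\{0,\dots,K-1\}^N\to\{0,\dots,K-1\}^N$ with $f_t(m,x)\le x$ coordinatewise (cell levels can only decrease), and a decoder $g_t:\{0,\dots,K-1\}^N\to\mathcal M_t$. Given messages $M(1),\dots,M(T)$, independent with $M(t)$ uniform on $\mathcal M_t$, the states are $X(0)=(K-1,\dots,K-1)$ and $X(t)=f_t(M(t),X(t-1))$; the error probability is $\mathbb P(g_t(X(t))\ne M(t)\text{ for some }t)$, and the rate of round $t$ is $\frac1N\log_2|\mathcal M_t|$. A sequence of real numbers $l(1),\dots,l(T)$ is called achievable if for every $\epsilon>0$ and all sufficiently large $N$ there is a code on $N$ cells with error probability at most $\epsilon$ and with rate at least $l(t)-\epsilon$ in every round $t$. Theorem. The sequence $l(1),\dots,l(T)$ is achievable if and only if there exist jointly distributed random variables $U(0),U(1),\dots,U(T)$ with values in $\{0,\dots,K-1\}$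 such that $U(0)=K-1$ almost surely, $U(t)\le U(t-1)$ almost surely for $t=1,\dots,T$, $l(1)\le H(U(1))$, and $l(t)\le H(U(t)\mid U(t-1))$ for $t=2,\dots,T$, where $H$ denotes (conditional) entropy in bits. -/

import Mathlib

open MeasureTheory ProbabilityTheory Filter

noncomputable section

namespace Flash

/-- Entropy in bits, `H(X) = -∑ₓ P(X = x) log₂ P(X = x)`, of a random variable `X` with values in
a finite alphabet (`0 log 0 = 0`). -/
def entropy {Ω A : Type*} [MeasurableSpace Ω] [Fintype A] (P : Measure Ω) (X : Ω → A) : ℝ :=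
  -∑ x : A, P.real (X ⁻¹' {x}) * Real.logb 2 (P.real (X ⁻¹' {x}))

/-- Conditional entropy in bits, `H(Y | X) = ∑ₓ P(X = x) H(Y | X = x)`, where `H(Y | X = x)` is the
entropy of `Y` under the conditional probability `P(· | X = x)`. Values `x` of probability zero
contribute nothing. -/
def condEntropy {Ω A B : Type*} [MeasurableSpace Ω] [Fintype A] [Fintype B] (P : Measure Ω)
    (Y : Ω → B) (X : Ω → A) : ℝ :=
  ∑ x : A, P.real (X ⁻¹' {x}) * entropy (ProbabilityTheory.cond P (X ⁻¹' {x})) Y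

/-- The state of a block of `N` cells, each at one of the levels `0, …, K - 1`. -/
abbrev Block (N K : ℕ) : Type := Fin N → Fin K

/-- The level `K - 1` of a cell after an erase operation. -/
def topLevel (K : ℕ) [NeZero K] : Fin K :=
  ⟨K - 1, Nat.sub_lt (NeZero.pos K) Nat.one_pos⟩

/-- A scheme using a block of `N` cells with `K` levels for `T` rounds between two erasures.
The rounds `1, …, T` are indexed by `Fin T`. -/
structure Code (N K T : ℕ) where
  /-- the alphabet size of the message of each round -/
  size : Fin T → ℕ
  size_pos : ∀ t, 0 < size t
  /-- the new state of the block, from the new message and the current state -/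
  enc : ∀ t, Fin (size t) → Block N K → Block N K
  /-- programming never increases the level of a cell -/
  enc_le : ∀ t m x n, enc t m x n ≤ x n
  /-- the message that is read off the state of the block -/
  dec : ∀ t, Block N K → Fin (size t)

variable {N K T : ℕ}

/-- `c.state m t` is the state of the block after `t` rounds, for `t = 0, …, T`, when the messages
`m` are recorded one after the other. All cells start at level `K - 1`. -/
def Code.state [NeZero K] (c : Code N K T) (m : ∀ t, Fin (c.size t)) : Fin (T + 1) → Block N K :=
  Fin.induction (motive := fun _ => Block N K) (fun _ => topLevel K)
    (fun t x => c.enc t (m t) x)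

open Classical in
/-- The probability that at least one message is not recovered from the state of the block at the
end of its round, when the `T` messages are independent and uniformly distributed. -/
def Code.errorProb [NeZero K] (c : Code N K T) : ℝ :=
  ((Finset.univ.filter fun m : (∀ t, Fin (c.size t)) =>
      ∃ t : Fin T, c.dec t (c.state m t.succ) ≠ m t).card : ℝ) /
    (Fintype.card (∀ t, Fin (c.size t)) : ℝ)

/-- The data rate of a round, in bits per cell. -/
def Code.rate (c : Code N K T) (t : Fin T) : ℝ :=
  Real.logb 2 (c.size t) / N

/-- The rates `l` are (asymptotically) achievable: for every `ε > 0` and all sufficiently large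
`N` there is a scheme on `N` cells with error probability at most `ε` whose rate in each round `t`
is at least `l t - ε`. -/
def Achievable (K T : ℕ) [NeZero K] (l : Fin T → ℝ) : Prop :=
  ∀ ε : ℝ, 0 < ε → ∀ᶠ N : ℕ in atTop, ∃ c : Code N K T,
    c.errorProb ≤ ε ∧ ∀ t, l t - ε ≤ c.rate t

end Flash

end

/-!
Both directions pass through the joint law `ρ` of `U(0), …, U(T)`, a probability vector on the
histories of one cell (`historyLaws`): `exists_randomVariables_iff` identifies the condition of the
theorem with `l t * log 2 ≤ H_ρ(U(t) | U(t-1))` in nats for all rounds; the first round needs no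
special treatment because `U(0)` is constant.

Converse. For a code on `N` cells, let `G` be the set of correctly decoded message sequences and
let `ρ` be the law of the history of a uniformly chosen cell when the sequence is uniform on `G`.
Fix a round and let `q(b | a)` be the conditional law of the level after it given the level before.
Once the messages of the other rounds are fixed, the state before the round is fixed, and on `G`
distinct messages of the round lead to distinct new states, so that the products
`∏ n, q(X(t)ₙ | X(t-1)ₙ)` sum to at most one (`Code.sum_prod_le`). With `log x ≤ x - 1` this gives
`log (size t) + log β ≤ N H_ρ(U(t) | U(t-1))`, where `β` is the fraction of sequences in `G`
(`Code.log_size_le`); neither Fano's inequality nor the subadditivity of entropy is needed.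
Letting the slack tend to zero, a limit law exists by compactness of the simplex.

Achievability. There are codes with error probability zero. Choose histories of the `N` cells whose
empirical distribution approximates `ρ` (`exists_empirical`), and let the states after round `t` be
the rearrangements of the prescribed block of that round. Counting orbits of the symmetric group,
each such block can be moved to at least `D ≈ exp(N H_ρ(U(t) | U(t-1)))` states of the next round,
up to polynomial factors (`exp_natEntropy_le_card`). By the union bound a random colouring of the
blocks with about `D / N` colours shows every colour among the successors of every state
(`exists_colouring_blocks`). The message is the colour: it can always be written, and is always
read correctly (`exists_code_of_histories`).
-/

noncomputable section

namespace Flash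

/-! ### Entropy of weights on a finite set -/

section Weights

variable {A B C : Type*} [Fintype A] [Fintype C] [DecidableEq B] [DecidableEq C]

/-- The image under `X` of the weights `ρ`: the law of `X` when `ρ` is a probability vector. -/
def marginal (ρ : A → ℝ) (X : A → B) (b : B) : ℝ :=
  ∑ p with X p = b, ρ p

/-- The conditional entropy `H(Y | X) = H(X, Y) - H(X)` in nats under the weights `ρ`, which need
not be normalised, so that it also applies to counts. -/
def natEntropy [Fintype B] (ρ : A → ℝ) (Y : A → C) (X : A → B) : ℝ :=
  ∑ b, (∑ c, Real.negMulLog (marginal ρ (fun p => (X p, Y p)) (b, c)) -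
    Real.negMulLog (marginal ρ X b))


theorem marginal_nonneg {ρ : A → ℝ} (h : ∀ p, 0 ≤ ρ p) (X : A → B) (b : B) :
    0 ≤ marginal ρ X b :=
  Finset.sum_nonneg fun p _ => h p

theorem le_marginal {ρ : A → ℝ} (h : ∀ p, 0 ≤ ρ p) (X : A → B) (p : A) :
    ρ p ≤ marginal ρ X (X p) :=
  Finset.single_le_sum (f := ρ) (fun q _ => h q) (by simp)

theorem sum_marginal_mul [Fintype B] (ρ : A → ℝ) (X : A → B) (g : B → ℝ) :
    ∑ b, marginal ρ X b * g b = ∑ p, ρ p * g (X p) := by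
  rw [← Finset.sum_fiberwise (s := Finset.univ) (g := X)]
  refine Finset.sum_congr rfl fun b _ => ?_
  rw [marginal, Finset.sum_mul]
  refine Finset.sum_congr rfl fun p hp => ?_
  rw [(Finset.mem_filter.1 hp).2]

theorem sum_marginal_pair (ρ : A → ℝ) (X : A → B) (Y : A → C) (b : B) :
    ∑ c, marginal ρ (fun p => (X p, Y p)) (b, c) = marginal ρ X b := by
  rw [marginal, ← Finset.sum_fiberwise (s := Finset.univ.filter fun p => X p = b) (g := Y)]
  refine Finset.sum_congr rfl fun c _ => ?_
  rw [marginal, Finset.filter_filter]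
  simp only [Prod.mk.injEq]

theorem continuous_marginal (X : A → B) (b : B) :
    Continuous fun ρ : A → ℝ => marginal ρ X b := by
  unfold marginal
  fun_prop

theorem continuous_natEntropy [Fintype B] (Y : A → C) (X : A → B) :
    Continuous fun ρ : A → ℝ => natEntropy ρ Y X := by
  unfold natEntropy
  exact continuous_finsetSum _ fun b _ =>
    (continuous_finsetSum _ fun c _ =>
      Real.continuous_negMulLog.comp (continuous_marginal _ _)).sub
      (Real.continuous_negMulLog.comp (continuous_marginal _ _))

theorem marginal_const_mul (c : ℝ) (ρ : A → ℝ) (X : A → B) (b : B) :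
    marginal (fun p => c * ρ p) X b = c * marginal ρ X b := by
  simp only [marginal, Finset.mul_sum]

theorem natEntropy_const_mul [Fintype B] (c : ℝ) (ρ : A → ℝ) (Y : A → C) (X : A → B) :
    natEntropy (fun p => c * ρ p) Y X = c * natEntropy ρ Y X := by
  simp only [natEntropy, marginal_const_mul, Real.negMulLog_mul, Finset.mul_sum,
    Finset.sum_add_distrib]
  refine Finset.sum_congr rfl fun b _ => ?_
  rw [← Finset.sum_mul, sum_marginal_pair, ← Finset.mul_sum]
  ring

/-- The chain rule: the conditional entropy is the mean of `-log P(Y | X)`. -/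
theorem natEntropy_eq_sum [Fintype B] {ρ : A → ℝ} (h : ∀ p, 0 ≤ ρ p) (Y : A → C) (X : A → B) :
    natEntropy ρ Y X = -∑ p, ρ p * Real.log
      (marginal ρ (fun p => (X p, Y p)) (X p, Y p) / marginal ρ X (X p)) := by
  have h1 : ∀ p, ρ p * Real.log (marginal ρ (fun p => (X p, Y p)) (X p, Y p) /
      marginal ρ X (X p)) = ρ p * Real.log (marginal ρ (fun p => (X p, Y p)) (X p, Y p)) -
      ρ p * Real.log (marginal ρ X (X p)) := by
    intro p
    rcases (h p).eq_or_lt with h0 | h0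
    · simp [← h0]
    · rw [Real.log_div, mul_sub]
      · exact (h0.trans_le (le_marginal h (fun p => (X p, Y p)) p)).ne'
      · exact (h0.trans_le (le_marginal h X p)).ne'
  rw [Finset.sum_congr rfl fun p _ => h1 p, Finset.sum_sub_distrib,
    ← sum_marginal_mul ρ (fun p => (X p, Y p))
      (fun bc => Real.log (marginal ρ (fun p => (X p, Y p)) bc)),
    ← sum_marginal_mul ρ X (fun b => Real.log (marginal ρ X b)), Fintype.sum_prod_type]
  simp only [natEntropy, Real.negMulLog, Finset.sum_sub_distrib, neg_mul,
    Finset.sum_neg_distrib]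
  ring

end Weights

/-! ### Entropy of random variables -/

section RandomVariables

variable {Ω A B C : Type*} [MeasurableSpace Ω] [Fintype A] [Fintype C] [DecidableEq B]

theorem measureReal_preimage_comp [MeasurableSpace A] [MeasurableSingletonClass A]
    (P : Measure Ω) [IsFiniteMeasure P] {Z : Ω → A} (hZ : Measurable Z) (f : A → B) (b : B) :
    P.real ((fun ω => f (Z ω)) ⁻¹' {b}) = marginal (fun p => P.real (Z ⁻¹' {p})) f b := by
  have : (fun ω => f (Z ω)) ⁻¹' {b} =
      ⋃ p ∈ Finset.univ.filter (fun p => f p = b), Z ⁻¹' {p} := by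
    ext ω
    simp
  rw [this, measureReal_biUnion_finset, marginal]
  · intro p _ q _ hpq
    exact Disjoint.preimage Z (by simpa using hpq)
  · exact fun p _ => hZ (measurableSet_singleton p)

/-- Conditional entropy in bits is computed from the joint law. -/
theorem condEntropy_eq_natEntropy [Fintype B] [DecidableEq C] [MeasurableSpace A]
    [MeasurableSingletonClass A]
    (P : Measure Ω) [IsFiniteMeasure P] {Z : Ω → A} (hZ : Measurable Z) (f : A → B) (g : A → C) :
    condEntropy P (fun ω => g (Z ω)) (fun ω => f (Z ω)) =
      natEntropy (fun p => P.real (Z ⁻¹' {p})) g f / Real.log 2 := by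
  set ρ : A → ℝ := fun p => P.real (Z ⁻¹' {p})
  have h0 : ∀ p, 0 ≤ ρ p := fun p => measureReal_nonneg
  rw [condEntropy, natEntropy, Finset.sum_div]
  refine Finset.sum_congr rfl fun b _ => ?_
  have hms : MeasurableSet ((fun ω => f (Z ω)) ⁻¹' {b}) := by
    have : (fun ω => f (Z ω)) ⁻¹' {b} = Z ⁻¹' (f ⁻¹' {b}) := rfl
    rw [this]
    exact hZ (Set.toFinite _).measurableSet
  have hc : ∀ c, (ProbabilityTheory.cond P ((fun ω => f (Z ω)) ⁻¹' {b})).real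
      ((fun ω => g (Z ω)) ⁻¹' {c}) =
      (marginal ρ f b)⁻¹ * marginal ρ (fun p => (f p, g p)) (b, c) := by
    intro c
    rw [← measureReal_preimage_comp P hZ, ← measureReal_preimage_comp P hZ, measureReal_def,
      cond_apply hms, ENNReal.toReal_mul, ENNReal.toReal_inv, measureReal_def, measureReal_def]
    congr 3
    ext ω
    simp
  rw [entropy, Finset.sum_congr rfl fun c _ => by rw [hc c], measureReal_preimage_comp P hZ]
  change marginal ρ f b * _ = _
  have hsum := sum_marginal_pair ρ f g b
  have hnn := fun c => marginal_nonneg h0 (fun p => (f p, g p)) (b, c)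
  generalize marginal ρ f b = m at *
  rcases eq_or_ne m 0 with hm | hm
  · subst hm
    have hz := (Finset.sum_eq_zero_iff_of_nonneg fun c _ => hnn c).1 hsum
    rw [Finset.sum_congr rfl fun c hc => by rw [hz c hc]]
    have : ∑ c, Real.negMulLog (marginal ρ (fun p => (f p, g p)) (b, c)) = 0 :=
      Finset.sum_eq_zero fun c hc => by rw [hz c hc, Real.negMulLog_zero]
    simp [this]
  · have hterm : ∀ c, m⁻¹ * marginal ρ (fun p => (f p, g p)) (b, c) *
        Real.logb 2 (m⁻¹ * marginal ρ (fun p => (f p, g p)) (b, c)) =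
        -(m⁻¹ * (Real.negMulLog (marginal ρ (fun p => (f p, g p)) (b, c)) +
          marginal ρ (fun p => (f p, g p)) (b, c) * Real.log m) / Real.log 2) := by
      intro c
      rcases eq_or_ne (marginal ρ (fun p => (f p, g p)) (b, c)) 0 with h | h
      · simp [h]
      · rw [Real.logb, Real.log_mul (inv_ne_zero hm) h, Real.log_inv, Real.negMulLog]
        ring
    rw [Finset.sum_congr rfl fun c _ => hterm c, Finset.sum_neg_distrib, neg_neg,
      ← Finset.sum_div, ← Finset.mul_sum, Finset.sum_add_distrib, ← Finset.sum_mul, hsum]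
    simp only [Real.negMulLog]
    field_simp
    ring

/-- Conditioning on an almost surely constant random variable does not change the entropy. -/
theorem condEntropy_of_ae_eq_const {Ω B C : Type*} [MeasurableSpace Ω] [Fintype B] [Fintype C]
    (P : Measure Ω) [IsProbabilityMeasure P] {X : Ω → B} {b : B}
    (hX : ∀ᵐ ω ∂P, X ω = b) (Y : Ω → C) : condEntropy P Y X = entropy P Y := by
  rw [condEntropy, Finset.sum_eq_single b]
  · replace hX : ∀ᵐ ω ∂P, ω ∈ X ⁻¹' {b} := hX
    have h1 : P (X ⁻¹' {b}) = 1 :=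
      (measure_congr (eventuallyEq_univ.2 hX)).trans measure_univ
    rw [ProbabilityTheory.cond, measureReal_def, h1, Measure.restrict_eq_self_of_ae_mem hX]
    simp
  · intro a _ hab
    have : P (X ⁻¹' {a}) = 0 := measure_mono_null (fun ω hω hb => hab (hω.symm.trans hb))
      (ae_iff.1 hX)
    simp [measureReal_def, this]
  · simp

end RandomVariables

/-! ### The states of a code -/

section States

variable {N K T : ℕ} [NeZero K]

theorem Code.state_succ (c : Code N K T) (m : ∀ t, Fin (c.size t)) (t : Fin T) :
    c.state m t.succ = c.enc t (m t) (c.state m t.castSucc) := rfl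

/-- The state depends only on the messages that have been recorded so far. -/
theorem Code.state_congr (c : Code N K T) {m m' : ∀ t, Fin (c.size t)} (t : Fin (T + 1))
    (h : ∀ s : Fin T, s.castSucc < t → m s = m' s) : c.state m t = c.state m' t := by
  induction t using Fin.induction with
  | zero => rfl
  | succ t ih =>
    rw [c.state_succ, c.state_succ, h t Fin.castSucc_lt_succ,
      ih fun s hs => h s (hs.trans Fin.castSucc_lt_succ)]

end States

/-! ### The single-letter bound for a code -/

section Converse

theorem marginal_marginal {A B C : Type*} [Fintype A] [Fintype B] [DecidableEq B] [DecidableEq C]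
    (w : A → ℝ) (Z : A → B) (f : B → C) (c : C) :
    marginal (marginal w Z) f c = marginal w (fun p => f (Z p)) c := by
  have h := sum_marginal_mul w Z (fun b => if f b = c then 1 else 0)
  simpa [marginal, Finset.sum_filter] using h

theorem natEntropy_marginal {A B C D : Type*} [Fintype A] [Fintype B] [Fintype C] [Fintype D]
    [DecidableEq B] [DecidableEq C] [DecidableEq D] (w : A → ℝ) (Z : A → B) (Y : B → C)
    (X : B → D) :
    natEntropy (marginal w Z) Y X = natEntropy w (fun p => Y (Z p)) (fun p => X (Z p)) := by
  simp only [natEntropy, marginal_marginal]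

open Classical in
/-- The uniform probability weights on the pairs of a message sequence in `G` and a cell. -/
def pairWeight {M : Type*} (G : Finset M) (N : ℕ) (p : M × Fin N) : ℝ :=
  if p.1 ∈ G then ((G.card : ℝ) * N)⁻¹ else 0

theorem pairWeight_nonneg {M : Type*} (G : Finset M) (N : ℕ) (p : M × Fin N) :
    0 ≤ pairWeight G N p := by
  unfold pairWeight
  split_ifs <;> positivity

theorem sum_pairWeight_mul {M : Type*} [Fintype M] (G : Finset M) (N : ℕ) (f : M × Fin N → ℝ) :
    ∑ p, pairWeight G N p * f p = ((G.card : ℝ) * N)⁻¹ * ∑ m ∈ G, ∑ n, f (m, n) := by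
  classical
  rw [Fintype.sum_prod_type, Finset.mul_sum, ← Finset.sum_subset (Finset.subset_univ G)]
  · refine Finset.sum_congr rfl fun m hm => ?_
    simp [pairWeight, hm, Finset.mul_sum]
  · intro m _ hm
    simp [pairWeight, hm]

variable {N K T : ℕ} [NeZero K]

/-- A memoryless channel `q` charges, in the mean over all message sequences, at most a fraction
`1 / size t` of its mass to the transitions of round `t` on correctly decoded sequences: once the
other messages are fixed, distinct messages lead to distinct new states. -/
theorem Code.sum_prod_le (c : Code N K T) (t : Fin T) (G : Finset (∀ t, Fin (c.size t)))
    (hG : ∀ m ∈ G, c.dec t (c.state m t.succ) = m t) (q : Fin K → Fin K → ℝ)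
    (hq : ∀ a b, 0 ≤ q a b) (hq1 : ∀ a, ∑ b, q a b ≤ 1) :
    c.size t * ∑ m ∈ G, ∏ n, q (c.state m t.castSucc n) (c.state m t.succ n) ≤
      Fintype.card (∀ t, Fin (c.size t)) := by
  classical
  let e := Equiv.piSplitAt t fun s => Fin (c.size s)
  have hcard : Fintype.card (∀ t, Fin (c.size t)) =
      c.size t * Fintype.card (∀ s : {s // s ≠ t}, Fin (c.size s)) := by
    rw [Fintype.card_congr e, Fintype.card_prod, Fintype.card_fin]
  rw [hcard, Nat.cast_mul]
  refine mul_le_mul_of_nonneg_left ?_ (Nat.cast_nonneg _)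
  rw [← Finset.sum_fiberwise (s := G) (g := fun m => (e m).2)]
  have hone : ∀ r : (∀ s : {s // s ≠ t}, Fin (c.size s)),
      ∑ m ∈ G with (e m).2 = r, ∏ n, q (c.state m t.castSucc n) (c.state m t.succ n) ≤ 1 := by
    intro r
    rcases (G.filter fun m => (e m).2 = r).eq_empty_or_nonempty with h0 | ⟨m₀, hm₀⟩
    · rw [h0]
      simp
    · have heq : ∀ m ∈ G.filter (fun m => (e m).2 = r), ∀ s, s ≠ t → m s = m₀ s := by
        intro m hm s hs
        have h1 := (Finset.mem_filter.1 hm).2.trans (Finset.mem_filter.1 hm₀).2.symm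
        exact congrFun h1 ⟨s, hs⟩
      set x := c.state m₀ t.castSucc
      have hx : ∀ m ∈ G.filter (fun m => (e m).2 = r), c.state m t.castSucc = x := by
        intro m hm
        refine c.state_congr _ fun s hs => heq m hm s ?_
        exact (Fin.castSucc_lt_castSucc_iff.1 hs).ne
      have hinj : Set.InjOn (fun m => c.state m t.succ)
          (G.filter fun m => (e m).2 = r : Finset _) := by
        intro m hm m' hm' h
        funext s
        by_cases hs : s = t
        · subst hs
          rw [← hG m (Finset.mem_filter.1 hm).1, ← hG m' (Finset.mem_filter.1 hm').1]
          exact congrArg _ h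
        · rw [heq m hm s hs, heq m' hm' s hs]
      calc ∑ m ∈ G with (e m).2 = r, ∏ n, q (c.state m t.castSucc n) (c.state m t.succ n)
          = ∑ m ∈ G with (e m).2 = r, ∏ n, q (x n) (c.state m t.succ n) :=
            Finset.sum_congr rfl fun m hm => by rw [hx m hm]
        _ = ∑ y ∈ (G.filter fun m => (e m).2 = r).image fun m => c.state m t.succ,
              ∏ n, q (x n) (y n) := by
            rw [Finset.sum_image hinj]
        _ ≤ ∑ y : Fin N → Fin K, ∏ n, q (x n) (y n) :=
            Finset.sum_le_univ_sum_of_nonneg fun y => Finset.prod_nonneg fun n _ => hq _ _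
        _ = ∏ n, ∑ b, q (x n) b := (Fintype.prod_sum fun n b => q (x n) b).symm
        _ ≤ 1 := Finset.prod_le_one (fun n _ => Finset.sum_nonneg fun b _ => hq _ _)
            fun n _ => hq1 _
  calc _ ≤ ∑ r : (∀ s : {s // s ≠ t}, Fin (c.size s)), (1 : ℝ) :=
        Finset.sum_le_sum fun r _ => hone r
    _ = _ := by simp

/-- If the message of round `t` is decoded correctly on a fraction `β` of the message sequences,
then its rate is bounded by the conditional entropy of a transition of a uniformly chosen cell. -/
theorem Code.log_size_le (c : Code N K T) (hN : 0 < N) (t : Fin T)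
    (G : Finset (∀ t, Fin (c.size t))) (hG : ∀ m ∈ G, c.dec t (c.state m t.succ) = m t) {β : ℝ}
    (hβ : 0 < β) (hcard : β * Fintype.card (∀ t, Fin (c.size t)) ≤ G.card) :
    Real.log (c.size t) + Real.log β ≤ N * natEntropy (pairWeight G N)
      (fun p => c.state p.1 t.succ p.2) (fun p => c.state p.1 t.castSucc p.2) := by
  classical
  set w := pairWeight G N with hw
  set X : (∀ t, Fin (c.size t)) × Fin N → Fin K := fun p => c.state p.1 t.castSucc p.2
  set Y : (∀ t, Fin (c.size t)) × Fin N → Fin K := fun p => c.state p.1 t.succ p.2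
  have hw0 : ∀ p, 0 ≤ w p := pairWeight_nonneg G N
  let q : Fin K → Fin K → ℝ := fun a b => marginal w (fun p => (X p, Y p)) (a, b) / marginal w X a
  have hq : ∀ a b, 0 ≤ q a b := fun a b =>
    div_nonneg (marginal_nonneg hw0 _ _) (marginal_nonneg hw0 _ _)
  have hq1 : ∀ a, ∑ b, q a b ≤ 1 := fun a => by
    rw [← Finset.sum_div, sum_marginal_pair]
    exact div_self_le_one _
  have hmpos : 0 < Fintype.card (∀ t, Fin (c.size t)) :=
    Fintype.card_pos_iff.2 ⟨fun s => ⟨0, c.size_pos s⟩⟩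
  have hGpos : (0 : ℝ) < G.card := (mul_pos hβ (by exact_mod_cast hmpos)).trans_le hcard
  have hN' : (0 : ℝ) < N := by exact_mod_cast hN
  have hs : (0 : ℝ) < c.size t := by exact_mod_cast c.size_pos t
  have hqpos : ∀ m ∈ G, ∀ n, 0 < q (X (m, n)) (Y (m, n)) := by
    intro m hm n
    have h1 : 0 < w (m, n) := by
      simp only [hw, pairWeight, hm, if_true]
      positivity
    exact div_pos (h1.trans_le (le_marginal hw0 (fun p => (X p, Y p)) _))
      (h1.trans_le (le_marginal hw0 X _))
  let Q : (∀ t, Fin (c.size t)) → ℝ := fun m => ∏ n, q (X (m, n)) (Y (m, n))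
  have hent : (G.card : ℝ) * (N * natEntropy w Y X) = -∑ m ∈ G, Real.log (Q m) := by
    rw [natEntropy_eq_sum hw0]
    change (G.card : ℝ) * (N * -∑ p, w p * Real.log (q (X p) (Y p))) = _
    rw [sum_pairWeight_mul G N fun p => Real.log (q (X p) (Y p))]
    have : ∀ m ∈ G, Real.log (Q m) = ∑ n, Real.log (q (X (m, n)) (Y (m, n))) := fun m hm =>
      Real.log_prod fun n _ => (hqpos m hm n).ne'
    rw [Finset.sum_congr rfl this]
    field_simp
  have hsum := c.sum_prod_le t G hG q hq hq1
  change c.size t * ∑ m ∈ G, Q m ≤ _ at hsum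
  -- `log x ≤ x - 1` in place of Jensen's inequality
  have hlog : ∑ m ∈ G, (Real.log (Q m) + (Real.log (c.size t) + Real.log β)) ≤
      ∑ m ∈ G, (β * (c.size t * Q m) - 1) := by
    refine Finset.sum_le_sum fun m hm => ?_
    have hQ : 0 < Q m := Finset.prod_pos fun n _ => hqpos m hm n
    have := Real.log_le_sub_one_of_pos (mul_pos hβ (mul_pos hs hQ))
    rw [Real.log_mul hβ.ne' (mul_pos hs hQ).ne', Real.log_mul hs.ne' hQ.ne'] at this
    linarith
  rw [Finset.sum_add_distrib, Finset.sum_sub_distrib, ← Finset.mul_sum, ← Finset.mul_sum] at hlog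
  simp only [Finset.sum_const, nsmul_eq_mul, mul_one] at hlog
  have h2 : β * (c.size t * ∑ m ∈ G, Q m) ≤ G.card :=
    (mul_le_mul_of_nonneg_left hsum hβ.le).trans hcard
  refine le_of_mul_le_mul_left ?_ hGpos
  rw [hent]
  linarith

end Converse

/-! ### Laws of cell histories -/

section Histories

variable {N K T : ℕ}

/-- The conditional entropy, in nats, of the level after a round given the level before it. -/
def roundEntropy (ρ : (Fin (T + 1) → Fin K) → ℝ) (t : Fin T) : ℝ :=
  natEntropy ρ (fun p => p t.succ) (fun p => p t.castSucc)

theorem continuous_roundEntropy (t : Fin T) :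
    Continuous fun ρ : (Fin (T + 1) → Fin K) → ℝ => roundEntropy ρ t :=
  continuous_natEntropy _ _

variable [NeZero K]

/-- A history `p 0, …, p T` of the levels of one cell that starts at the top level and never
increases. -/
def IsHistory (p : Fin (T + 1) → Fin K) : Prop :=
  p 0 = topLevel K ∧ ∀ t : Fin T, p t.succ ≤ p t.castSucc

variable (K T) in
/-- The probability vectors on the histories of a cell: the joint laws of `U(0), …, U(T)` that the
theorem allows. -/
def historyLaws : Set ((Fin (T + 1) → Fin K) → ℝ) :=
  {ρ | ρ ∈ stdSimplex ℝ (Fin (T + 1) → Fin K) ∧ ∀ p, ¬ IsHistory p → ρ p = 0}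

theorem isCompact_historyLaws : IsCompact (historyLaws K T) := by
  have : historyLaws K T = stdSimplex ℝ (Fin (T + 1) → Fin K) ∩
      {ρ | ∀ p, ¬ IsHistory p → ρ p = 0} := rfl
  rw [this]
  refine (isCompact_stdSimplex ℝ _).inter_right ?_
  simp only [Set.ofPred_forall]
  exact isClosed_iInter fun p => isClosed_iInter fun _ =>
    isClosed_eq (continuous_apply p) continuous_const

theorem Code.isHistory (c : Code N K T) (m : ∀ t, Fin (c.size t)) (n : Fin N) :
    IsHistory fun s => c.state m s n :=
  ⟨rfl, fun t => c.enc_le t (m t) _ n⟩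

/-- The law of the history of a uniformly chosen cell when the message sequence is uniform
on `G`. -/
def Code.cellLaw (c : Code N K T) (G : Finset (∀ t, Fin (c.size t))) :
    (Fin (T + 1) → Fin K) → ℝ :=
  marginal (pairWeight G N) fun p s => c.state p.1 s p.2

theorem Code.cellLaw_mem (c : Code N K T) (hN : 0 < N) {G : Finset (∀ t, Fin (c.size t))}
    (hG : G.Nonempty) : c.cellLaw G ∈ historyLaws K T := by
  refine ⟨⟨fun p => marginal_nonneg (pairWeight_nonneg G N) _ p, ?_⟩, fun p hp => ?_⟩
  · have h1 := sum_marginal_mul (pairWeight G N) (fun p s => c.state p.1 s p.2) fun _ => 1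
    rw [sum_pairWeight_mul] at h1
    have hc : (G.card : ℝ) ≠ 0 := by exact_mod_cast hG.card_pos.ne'
    have hN' : (N : ℝ) ≠ 0 := by exact_mod_cast hN.ne'
    simp only [mul_one, Finset.sum_const, nsmul_eq_mul, Finset.card_univ, Fintype.card_fin] at h1
    rw [inv_mul_cancel₀ (mul_ne_zero hc hN')] at h1
    exact h1
  · refine Finset.sum_eq_zero fun x hx => ?_
    exact absurd ((Finset.mem_filter.1 hx).2 ▸ c.isHistory x.1 x.2) hp

/-- A code of large length and small error probability has a cell law that satisfies the entropy
bounds up to `ε`. -/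
theorem exists_historyLaw_approx {l : Fin T → ℝ} (h : Achievable K T l) {ε : ℝ} (hε : 0 < ε) :
    ∃ ρ ∈ historyLaws K T, ∀ t, (l t - ε) * Real.log 2 ≤ roundEntropy ρ t := by
  classical
  -- One half of `ε` is lost to the rate of the code, the other to `log β / N` with `β = 1 / 2`.
  set δ := min (ε / 2) (1 / 2)
  have hδ : 0 < δ := lt_min (by linarith) (by norm_num)
  have hδ1 : δ ≤ ε / 2 := min_le_left _ _
  have hδ2 : δ ≤ 1 / 2 := min_le_right _ _
  obtain ⟨N, ⟨c, herr, hrate⟩, hN⟩ := ((h δ hδ).and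
    (eventually_ge_atTop (⌈2 / ε⌉₊ + 1))).exists
  have hN0 : 0 < N := by omega
  have hN' : (0 : ℝ) < N := by exact_mod_cast hN0
  have hNε : 2 / ε ≤ N := (Nat.le_ceil _).trans (by exact_mod_cast (by omega))
  set G : Finset (∀ t, Fin (c.size t)) :=
    Finset.univ.filter fun m => ¬ ∃ t : Fin T, c.dec t (c.state m t.succ) ≠ m t
  have hmpos : (0 : ℝ) < Fintype.card (∀ t, Fin (c.size t)) := by
    have : Nonempty (∀ t, Fin (c.size t)) := ⟨fun s => ⟨0, c.size_pos s⟩⟩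
    exact_mod_cast Fintype.card_pos
  have hcard : (1 / 2 : ℝ) * Fintype.card (∀ t, Fin (c.size t)) ≤ G.card := by
    have h1 := Finset.card_filter_add_card_filter_not (s := Finset.univ)
      (fun m : (∀ t, Fin (c.size t)) => ∃ t : Fin T, c.dec t (c.state m t.succ) ≠ m t)
    rw [Code.errorProb, div_le_iff₀ hmpos] at herr
    rw [Finset.card_univ] at h1
    have h2 : (((Finset.univ.filter fun m : (∀ t, Fin (c.size t)) =>
      ∃ t : Fin T, c.dec t (c.state m t.succ) ≠ m t).card : ℝ)) + G.card =
      Fintype.card (∀ t, Fin (c.size t)) := by exact_mod_cast h1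
    have h3 := mul_le_mul_of_nonneg_right hδ2 hmpos.le
    have h4 : (((Finset.univ.filter fun m : (∀ t, Fin (c.size t)) =>
      ∃ t : Fin T, c.dec t (c.state m t.succ) ≠ m t).card : ℝ)) ≤
      1 / 2 * Fintype.card (∀ t, Fin (c.size t)) := by
        refine le_trans (le_of_eq ?_) (herr.trans h3)
        congr!
    linarith
  have hG : G.Nonempty := by
    rw [← Finset.card_pos]
    have : (0 : ℝ) < G.card := lt_of_lt_of_le (by positivity) hcard
    exact_mod_cast this
  refine ⟨c.cellLaw G, c.cellLaw_mem hN0 hG, fun t => ?_⟩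
  have hmain := c.log_size_le hN0 t G
    (fun m hm => by
      have := (Finset.mem_filter.1 hm).2
      push Not at this
      exact this t) (by norm_num) hcard
  have hent : roundEntropy (c.cellLaw G) t = natEntropy (pairWeight G N)
      (fun p => c.state p.1 t.succ p.2) (fun p => c.state p.1 t.castSucc p.2) :=
    natEntropy_marginal _ _ _ _
  rw [← hent] at hmain
  have hr := hrate t
  have hlog2 : 0 < Real.log 2 := Real.log_pos one_lt_two
  rw [Code.rate, Real.logb, div_div, le_div_iff₀ (by positivity)] at hr
  rw [one_div, Real.log_inv] at hmain
  have h1 : 2 ≤ N * ε := by rwa [div_le_iff₀ hε] at hNε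
  refine le_of_mul_le_mul_left ?_ hN'
  have h2 : (N : ℝ) * Real.log 2 * δ ≤ N * Real.log 2 * (ε / 2) :=
    mul_le_mul_of_nonneg_left hδ1 (by positivity)
  have h3 := mul_le_mul_of_nonneg_right h1 hlog2.le
  linarith

/-- The converse in terms of laws; compactness removes the slack. -/
theorem exists_historyLaw_of_achievable {l : Fin T → ℝ} (h : Achievable K T l) :
    ∃ ρ ∈ historyLaws K T, ∀ t, l t * Real.log 2 ≤ roundEntropy ρ t := by
  let C : ℕ → Set ((Fin (T + 1) → Fin K) → ℝ) := fun k =>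
    historyLaws K T ∩ {ρ | ∀ t, (l t - 1 / ((k : ℝ) + 1)) * Real.log 2 ≤ roundEntropy ρ t}
  have hclosed : ∀ k, IsClosed
      {ρ : (Fin (T + 1) → Fin K) → ℝ |
        ∀ t, (l t - 1 / ((k : ℝ) + 1)) * Real.log 2 ≤ roundEntropy ρ t} := by
    intro k
    simp only [Set.ofPred_forall]
    exact isClosed_iInter fun t => isClosed_le continuous_const (continuous_roundEntropy t)
  have hC : ∀ k, IsCompact (C k) := fun k => isCompact_historyLaws.inter_right (hclosed k)
  have hlog2 : 0 < Real.log 2 := Real.log_pos one_lt_two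
  obtain ⟨ρ, hρ⟩ := IsCompact.nonempty_iInter_of_sequence_nonempty_isCompact_isClosed C
    (fun k ρ hρ => ⟨hρ.1, fun t => le_trans (mul_le_mul_of_nonneg_right
      (sub_le_sub_left (Nat.one_div_le_one_div k.le_succ) _) hlog2.le) (hρ.2 t)⟩)
    (fun k => (exists_historyLaw_approx h (by positivity)).imp fun _ hρ => hρ)
    (hC 0) (fun k => (hC k).isClosed)
  rw [Set.mem_iInter] at hρ
  refine ⟨ρ, (hρ 0).1, fun t => ?_⟩
  have hlim : Tendsto (fun k : ℕ => (l t - 1 / ((k : ℝ) + 1)) * Real.log 2) atTop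
      (nhds ((l t - 0) * Real.log 2)) :=
    (tendsto_const_nhds.sub tendsto_one_div_add_atTop_nhds_zero_nat).mul_const _
  rw [sub_zero] at hlim
  exact le_of_tendsto' hlim fun k => (hρ k).2 t

/-- The condition of the theorem on random variables is a condition on their joint law. -/
theorem exists_randomVariables_iff (l : Fin T → ℝ) :
    (∃ (Ω : Type) (_ : MeasurableSpace Ω) (P : Measure Ω) (U : Fin (T + 1) → Ω → Fin K),
        IsProbabilityMeasure P ∧ (∀ t, Measurable (U t)) ∧
        (∀ᵐ ω ∂P, U 0 ω = topLevel K) ∧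
        (∀ t : Fin T, ∀ᵐ ω ∂P, U t.succ ω ≤ U t.castSucc ω) ∧
        (∀ t : Fin T, t.val = 0 → l t ≤ entropy P (U t.succ)) ∧
        (∀ t : Fin T, t.val ≠ 0 → l t ≤ condEntropy P (U t.succ) (U t.castSucc))) ↔
      ∃ ρ ∈ historyLaws K T, ∀ t, l t * Real.log 2 ≤ roundEntropy ρ t := by
  have hlog2 : 0 < Real.log 2 := Real.log_pos one_lt_two
  constructor
  · rintro ⟨Ω, _, P, U, hP, hU, h0, hle, hl0, hl1⟩
    have hZ : Measurable fun ω t => U t ω := measurable_pi_lambda _ hU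
    refine ⟨fun p => P.real ((fun ω t => U t ω) ⁻¹' {p}),
      ⟨⟨fun p => measureReal_nonneg, ?_⟩, fun p hp => ?_⟩, fun t => ?_⟩
    · have := measureReal_preimage_comp P hZ (fun _ => ()) ()
      simpa [marginal] using this.symm
    · have hae : ∀ᵐ ω ∂P, IsHistory fun t => U t ω := by
        filter_upwards [h0, ae_all_iff.2 hle] with ω h1 h2 using ⟨h1, h2⟩
      have : P ((fun ω t => U t ω) ⁻¹' {p}) = 0 :=
        measure_mono_null (fun ω (hω : _ = p) h => hp (hω ▸ h)) (ae_iff.1 hae)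
      simp [measureReal_def, this]
    · have hcond : l t ≤ condEntropy P (U t.succ) (U t.castSucc) := by
        by_cases ht : t.val = 0
        · have hz : t.castSucc = 0 := Fin.ext ht
          rw [hz, condEntropy_of_ae_eq_const P h0]
          exact hl0 t ht
        · exact hl1 t ht
      have := condEntropy_eq_natEntropy P hZ (fun p => p t.castSucc) fun p => p t.succ
      rw [← le_div_iff₀ hlog2]
      exact hcond.trans_eq this
  · rintro ⟨ρ, ⟨⟨hρ0, hρ1⟩, hρ⟩, hl⟩
    let f : PMF (Fin (T + 1) → Fin K) := PMF.ofFintype (fun p => ENNReal.ofReal (ρ p)) (by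
      rw [← ENNReal.ofReal_sum_of_nonneg fun p _ => hρ0 p, hρ1, ENNReal.ofReal_one])
    have hreal : ∀ p, f.toMeasure.real {p} = ρ p := fun p => by
      rw [measureReal_def, PMF.toMeasure_apply_singleton _ _ (measurableSet_singleton p)]
      exact ENNReal.toReal_ofReal (hρ0 p)
    have hae : ∀ᵐ p ∂f.toMeasure, IsHistory p := by
      refine ae_iff.2 ((measure_null_iff_singleton (Set.to_countable _)).2 fun p hp => ?_)
      rw [PMF.toMeasure_apply_singleton _ _ (measurableSet_singleton p)]
      exact (congrArg ENNReal.ofReal (hρ p hp)).trans ENNReal.ofReal_zero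
    have hbound : ∀ t, l t ≤
        condEntropy f.toMeasure (fun p => p t.succ) (fun p => p t.castSucc) := by
      intro t
      have := condEntropy_eq_natEntropy f.toMeasure measurable_id
        (fun p => p t.castSucc) fun p => p t.succ
      refine le_of_le_of_eq ?_ this.symm
      rw [le_div_iff₀ hlog2]
      refine (hl t).trans_eq ?_
      rw [roundEntropy]
      congr 1
      exact funext fun p => (hreal p).symm
    refine ⟨_, inferInstance, f.toMeasure, fun t p => p t, inferInstance,
      fun t => measurable_pi_apply t, hae.mono fun p hp => hp.1,
      fun t => hae.mono fun p hp => hp.2 t, fun t ht => ?_, fun t _ => hbound t⟩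
    have hz : t.castSucc = 0 := Fin.ext ht
    refine (hbound t).trans_eq (condEntropy_of_ae_eq_const _ (b := topLevel K) ?_ _)
    rw [hz]
    exact hae.mono fun p hp => hp.1

end Histories

/-! ### Colourings that are surjective on many sets -/

section Colouring

/-- Among all colourings with `M` colours there is one for which every set `V x` contains every
colour, by the union bound over the pairs of a set and a missing colour. -/
theorem exists_colouring {X Y : Type*} [Fintype Y] (S : Finset X) (V : X → Finset Y) {D M : ℕ}
    (hM : 0 < M) (hV : ∀ x ∈ S, D ≤ (V x).card) (h : S.card * M * (M - 1) ^ D < M ^ D) :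
    ∃ g : Y → Fin M, ∀ x ∈ S, ∀ m, ∃ y ∈ V x, g y = m := by
  classical
  by_contra! hbad
  have : NeZero M := ⟨hM.ne'⟩
  obtain ⟨x₀, hx₀, -⟩ := hbad fun _ => 0
  have hDY : D ≤ Fintype.card Y := (hV x₀ hx₀).trans (Finset.card_le_univ _)
  let W : X × Fin M → Finset (Y → Fin M) := fun xm =>
    Fintype.piFinset fun y => if y ∈ V xm.1 then Finset.univ.erase xm.2 else Finset.univ
  have hsub : (Finset.univ : Finset (Y → Fin M)) ⊆ (S ×ˢ Finset.univ).biUnion W := by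
    intro g _
    obtain ⟨x, hx, m, hm⟩ := hbad g
    refine Finset.mem_biUnion.2 ⟨(x, m), by simp [hx], Fintype.mem_piFinset.2 fun y => ?_⟩
    by_cases hy : y ∈ V x
    · simpa [hy] using hm y hy
    · simp [hy]
  -- Restricting to `D` elements of `V x` gives a bound that does not depend on the size of `V x`.
  have hW : ∀ xm ∈ S ×ˢ (Finset.univ : Finset (Fin M)),
      (W xm).card ≤ (M - 1) ^ D * M ^ (Fintype.card Y - D) := by
    intro xm hxm
    have hx := hV xm.1 (Finset.mem_product.1 hxm).1
    obtain ⟨V', hV', hcard⟩ := Finset.exists_subset_card_eq hx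
    rw [Fintype.card_piFinset, ← Finset.prod_mul_prod_compl V']
    refine Nat.mul_le_mul ?_ ?_
    · rw [Finset.prod_congr rfl fun y hy => by rw [if_pos (hV' hy)]]
      simp [hcard]
    · calc _ ≤ ∏ _y ∈ V'ᶜ, M := Finset.prod_le_prod' fun y _ => by
            split_ifs <;> simp
        _ = _ := by rw [Finset.prod_const, Finset.card_compl, hcard]
  have hcount := (Finset.card_le_card hsub).trans (Finset.card_biUnion_le_card_mul _ _ _ hW)
  rw [Finset.card_product, Finset.card_univ, Finset.card_univ, Fintype.card_fun, Fintype.card_fin,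
    ← Nat.add_sub_of_le hDY, pow_add, ← mul_assoc, Nat.add_sub_of_le hDY] at hcount
  exact absurd (Nat.le_of_mul_le_mul_right hcount (pow_pos hM _)) h.not_ge

/-- If every set `V x`, for `x` in a set of blocks, has at least `D` elements, then about `D` many
colours, up to a factor linear in `N`, can be made to appear in all the sets `V x`. -/
theorem exists_colouring_blocks {N K : ℕ} [NeZero K] (hN : 0 < N) (S : Finset (Block N K))
    (V : Block N K → Finset (Block N K)) {D : ℕ} (hD : 0 < D) (hV : ∀ x ∈ S, D ≤ (V x).card) :
    ∃ M : ℕ, 0 < M ∧ D ≤ 6 * N * K * M ∧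
      ∃ g : Block N K → Fin M, ∀ x ∈ S, ∀ m, ∃ y ∈ V x, g y = m := by
  have hK : 0 < K := NeZero.pos K
  have hNK : 0 < 3 * N * K := by positivity
  -- Too few elements for the choice `M = D / (3NK)`: one colour suffices.
  rcases lt_or_ge D (3 * N * K) with hlt | hge
  · refine ⟨1, one_pos, by nlinarith, exists_colouring S V one_pos hV ?_⟩
    simp [hD.ne']
  set M := D / (3 * N * K)
  have hM : 0 < M := Nat.div_pos hge hNK
  have hMD : M * (3 * N * K) ≤ D := Nat.div_mul_le_self _ _
  have hDM : D < (M + 1) * (3 * N * K) := by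
    rw [mul_comm]
    exact Nat.lt_mul_div_succ D hNK
  refine ⟨M, hM, by nlinarith, exists_colouring S V hM hV ?_⟩
  rcases S.eq_empty_or_nonempty with rfl | ⟨x, hx⟩
  · simpa using pow_pos hM D
  have hblock : Fintype.card (Block N K) = K ^ N := by simp
  have hMK : M ≤ K ^ N := by
    refine (Nat.div_le_self _ _).trans ((hV x hx).trans ?_)
    exact (Finset.card_le_univ _).trans_eq hblock
  -- A set misses a given colour for a fraction at most `exp (-D / M) ≤ exp (-3NK)` of the
  -- colourings, and there are at most `K ^ N * K ^ N ≤ exp (2NK)` pairs of a set and a colour.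
  have hSK : S.card ≤ K ^ N := (Finset.card_le_univ _).trans_eq hblock
  have hMr : (0 : ℝ) < M := by exact_mod_cast hM
  have hNr : (0 : ℝ) < N := by exact_mod_cast hN
  have hKr : (0 : ℝ) < K := by exact_mod_cast hK
  have hexp : ((M - 1 : ℕ) : ℝ) ^ D ≤ M ^ D * Real.exp (-(3 * N * K)) := by
    have h1 : ((M - 1 : ℕ) : ℝ) ≤ M * Real.exp (-(1 / M)) := by
      rw [Nat.cast_sub hM]
      have := mul_le_mul_of_nonneg_left (Real.add_one_le_exp (-(1 / (M : ℝ)))) hMr.le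
      refine le_trans (le_of_eq ?_) this
      field_simp
      simp
      ring
    calc ((M - 1 : ℕ) : ℝ) ^ D ≤ (M * Real.exp (-(1 / M))) ^ D :=
          pow_le_pow_left₀ (Nat.cast_nonneg _) h1 D
      _ = M ^ D * Real.exp (-(D / M)) := by
          rw [mul_pow, ← Real.exp_nat_mul]
          ring_nf
      _ ≤ _ := by
          gcongr
          rw [le_div_iff₀ hMr]
          have : ((M * (3 * N * K) : ℕ) : ℝ) ≤ D := by exact_mod_cast hMD
          push_cast at this
          linarith
  have hKexp : ((K : ℝ) ^ N) ≤ Real.exp (N * K) := by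
    rw [Real.exp_nat_mul]
    gcongr
    linarith [Real.add_one_le_exp (K : ℝ)]
  have hfinal : (S.card : ℝ) * M * ((M - 1 : ℕ) : ℝ) ^ D < M ^ D := by
    calc (S.card : ℝ) * M * ((M - 1 : ℕ) : ℝ) ^ D
        ≤ Real.exp (N * K) * Real.exp (N * K) * (M ^ D * Real.exp (-(3 * N * K))) := by
          have h1 : (S.card : ℝ) ≤ Real.exp (N * K) := le_trans (by exact_mod_cast hSK) hKexp
          have h2 : (M : ℝ) ≤ Real.exp (N * K) := le_trans (by exact_mod_cast hMK) hKexp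
          gcongr
      _ = M ^ D * Real.exp (-(N * K)) := by
          rw [← Real.exp_add, mul_left_comm, ← Real.exp_add]
          ring_nf
      _ < M ^ D * 1 := by
          gcongr
          rw [Real.exp_lt_one_iff]
          have := mul_pos hNr hKr
          linarith
      _ = M ^ D := mul_one _
  exact_mod_cast hfinal

end Colouring

/-! ### Counting the blocks of a given joint type -/

section Types

variable {ι B C : Type*} [Fintype ι] [DecidableEq ι] [Fintype B] [Fintype C] [DecidableEq B]
  [DecidableEq C]

open Nat in
theorem card_perm_comp_eq (f : ι → B) (σ : Equiv.Perm ι) :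
    (Finset.univ.filter fun τ : Equiv.Perm ι => f ∘ τ = f ∘ σ).card =
      ∏ b, (Finset.univ.filter fun i => f i = b).card ! := by
  have h := DomMulAct.stabilizer_card f
  simp only [Fintype.card_subtype] at h
  rw [← h]
  refine Finset.card_bij (fun τ _ => τ * σ⁻¹) ?_ ?_ ?_
  · intro τ hτ
    have := (Finset.mem_filter.1 hτ).2
    refine Finset.mem_filter.2 ⟨Finset.mem_univ _, ?_⟩
    funext i
    have := congrFun this (σ⁻¹ i)
    simpa using this
  · intro τ _ τ' _ h
    exact mul_right_cancel h
  · intro τ hτ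
    refine ⟨τ * σ, Finset.mem_filter.2 ⟨Finset.mem_univ _, ?_⟩, by simp⟩
    have := (Finset.mem_filter.1 hτ).2
    funext i
    exact congrFun this (σ i)

open Nat in
/-- Orbit counting for the permutations of the cells: the stabiliser of `x` moves `y` around the
blocks that have the same joint type with `x`. -/
theorem prod_factorial_le (x : ι → B) (y : ι → C) (σ : Equiv.Perm ι) :
    ∏ b, (Finset.univ.filter fun i => x i = b).card ! ≤
      (∏ bc, (Finset.univ.filter fun i => (x i, y i) = bc).card !) *
        ((Finset.univ.filter fun τ : Equiv.Perm ι => x ∘ τ = x ∘ σ).image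
          fun τ : Equiv.Perm ι => y ∘ τ).card := by
  rw [← card_perm_comp_eq x σ]
  refine Finset.card_le_mul_card_image _ _ fun z hz => ?_
  obtain ⟨τ, hτ, rfl⟩ := Finset.mem_image.1 hz
  rw [← card_perm_comp_eq (fun i => (x i, y i)) τ]
  refine Finset.card_le_card fun υ hυ => ?_
  simp only [Finset.mem_filter, Finset.mem_univ, true_and] at hυ hτ ⊢
  funext i
  exact Prod.ext (congrFun (hυ.1.trans hτ.symm) i) (congrFun hυ.2 i)

theorem le_log_factorial (n : ℕ) : -Real.negMulLog n - n ≤ Real.log n.factorial := by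
  rcases eq_or_ne n 0 with rfl | hn
  · simp
  have h := Stirling.le_log_factorial_stirling hn
  have h1 : 0 ≤ Real.log n := Real.log_natCast_nonneg n
  have h2 : 0 ≤ Real.log (2 * Real.pi) := Real.log_nonneg (by linarith [Real.pi_gt_three])
  rw [Real.negMulLog]
  linarith

/-- The Stirling sequence is decreasing from `n = 1` on, so its first term bounds `n!`. -/
theorem log_factorial_le (n : ℕ) :
    Real.log n.factorial ≤ -Real.negMulLog n - n + (Real.log (n + 1) + 1) := by
  rcases n with _ | n
  · simp
  have h := Stirling.log_stirlingSeq'_antitone (Nat.zero_le n)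
  simp only [Function.comp_apply, Stirling.log_stirlingSeq_formula] at h
  have hn : (0 : ℝ) < (n : ℝ) + 1 := by positivity
  have hlog : Real.log ((n : ℝ) + 1) ≤ Real.log ((n : ℝ) + 1 + 1) :=
    Real.log_le_log hn (by linarith)
  have hn0 : 0 ≤ Real.log ((n : ℝ) + 1) := Real.log_nonneg (by linarith [n.cast_nonneg (α := ℝ)])
  rw [Real.log_mul two_ne_zero (by positivity), Real.log_div (by positivity) (by positivity),
    Real.log_exp] at h
  simp only [Nat.succ_eq_add_one, Real.negMulLog] at *
  push_cast at *
  simp at h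
  nlinarith

theorem marginal_one {ι B : Type*} [Fintype ι] [DecidableEq B] (f : ι → B) (b : B) :
    marginal (fun _ => 1) f b = ((Finset.univ.filter fun i => f i = b).card : ℝ) := by
  simp [marginal]

/-- The number of blocks of the joint type of `(x, y)` with a given rearrangement of `x` is
`exp (N H(y | x))` up to a polynomial factor. -/
theorem exp_natEntropy_le_card (x : ι → B) (y : ι → C) (σ : Equiv.Perm ι) :
    Real.exp (natEntropy (fun _ => 1) y x -
      Fintype.card (B × C) * (Real.log (Fintype.card ι + 1) + 1)) ≤
      ((Finset.univ.filter fun τ : Equiv.Perm ι => x ∘ τ = x ∘ σ).image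
          fun τ : Equiv.Perm ι => y ∘ τ).card := by
  set V := (Finset.univ.filter fun τ : Equiv.Perm ι => x ∘ τ = x ∘ σ).image
    fun τ : Equiv.Perm ι => y ∘ τ
  have hV : (0 : ℝ) < V.card := by
    have : V.Nonempty := ⟨y ∘ σ, Finset.mem_image_of_mem _ (by simp)⟩
    exact_mod_cast this.card_pos
  rw [← Real.le_log_iff_exp_le hV]
  have hle : ((∏ b, (Finset.univ.filter fun i => x i = b).card.factorial : ℕ) : ℝ) ≤
      ((∏ bc, (Finset.univ.filter fun i => (x i, y i) = bc).card.factorial : ℕ) : ℝ) * V.card := by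
    exact_mod_cast prod_factorial_le x y σ
  have hpos : ∀ n : ℕ, (n.factorial : ℝ) ≠ 0 := fun n => by exact_mod_cast n.factorial_ne_zero
  push_cast at hle
  have hlog := Real.log_le_log (Finset.prod_pos fun b _ => by positivity) hle
  rw [Real.log_mul (Finset.prod_ne_zero_iff.2 fun _ _ => hpos _) hV.ne',
    Real.log_prod fun _ _ => hpos _, Real.log_prod fun _ _ => hpos _] at hlog
  set k : B → ℕ := fun b => (Finset.univ.filter fun i => x i = b).card
  set j : B × C → ℕ := fun bc => (Finset.univ.filter fun i => (x i, y i) = bc).card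
  have h1 : ∑ b, (-Real.negMulLog (k b) - k b) ≤ ∑ b, Real.log (k b).factorial :=
    Finset.sum_le_sum fun b _ => le_log_factorial _
  have h2 : ∑ bc, Real.log (j bc).factorial ≤ ∑ bc, (-Real.negMulLog (j bc) - j bc +
      (Real.log (Fintype.card ι + 1) + 1)) := by
    refine Finset.sum_le_sum fun bc _ => (log_factorial_le _).trans ?_
    have : (j bc : ℝ) ≤ Fintype.card ι := by exact_mod_cast Finset.card_le_univ _
    gcongr
  have hent : natEntropy (fun _ => 1) y x =
      ∑ bc, Real.negMulLog (j bc) - ∑ b, Real.negMulLog (k b) := by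
    simp only [natEntropy, marginal_one, Finset.sum_sub_distrib, Fintype.sum_prod_type]
    rfl
  have hcount : ∑ bc, (j bc : ℝ) = ∑ b, (k b : ℝ) := by
    rw [Fintype.sum_prod_type]
    refine Finset.sum_congr rfl fun b _ => ?_
    have := sum_marginal_pair (fun _ : ι => (1 : ℝ)) x y b
    simpa only [marginal_one] using this
  rw [Finset.sum_add_distrib] at h2
  simp only [Finset.sum_sub_distrib, Finset.sum_neg_distrib, Finset.sum_const, nsmul_eq_mul,
    Finset.card_univ] at h1 h2
  rw [hent]
  linarith

end Types

/-! ### Codes without error -/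

section ZeroError

variable {N K T : ℕ} [NeZero K]

/-- Colourings of the blocks, one for each round, that show every colour below every admissible
block give a code without error: a message is written by moving to a block of its colour. -/
theorem exists_code_of_colouring (S : Fin (T + 1) → Set (Block N K))
    (h0 : (fun _ => topLevel K) ∈ S 0) (size : Fin T → ℕ) (hsize : ∀ t, 0 < size t)
    (g : ∀ t, Block N K → Fin (size t))
    (hg : ∀ t : Fin T, ∀ x ∈ S t.castSucc, ∀ m, ∃ y ∈ S t.succ, y ≤ x ∧ g t y = m) :
    ∃ c : Code N K T, c.size = size ∧ c.errorProb = 0 := by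
  classical
  choose! f hfS hfle hfg using hg
  let c : Code N K T :=
    { size := size
      size_pos := hsize
      enc := fun t m x => if x ∈ S t.castSucc then f t x m else x
      enc_le := fun t m x n => by
        split_ifs with hx
        · exact hfle t x hx m n
        · exact le_rfl
      dec := g }
  have hstate : ∀ (m : ∀ t, Fin (c.size t)) (t : Fin (T + 1)), c.state m t ∈ S t := by
    intro m t
    induction t using Fin.induction with
    | zero => exact h0
    | succ t ih =>
      rw [c.state_succ]
      change (if c.state m t.castSucc ∈ S t.castSucc then _ else _) ∈ _
      rw [if_pos ih]
      exact hfS t _ ih _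
  refine ⟨c, rfl, ?_⟩
  have hdec : ∀ (m : ∀ t, Fin (c.size t)) (t : Fin T), c.dec t (c.state m t.succ) = m t := by
    intro m t
    rw [c.state_succ]
    change g t (if c.state m t.castSucc ∈ S t.castSucc then _ else _) = _
    rw [if_pos (hstate m _)]
    exact hfg t _ (hstate m _) _
  rw [Code.errorProb, Finset.filter_false_of_mem]
  · simp
  · rintro m - ⟨t, ht⟩
    exact ht (hdec m t)

/-- From prescribed histories of the cells one gets a code without error whose rates are the
conditional entropies of the empirical distribution of the histories, up to polynomial factors in
the alphabet sizes. Its states are the rearrangements of the prescribed ones. -/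
theorem exists_code_of_histories (hN : 0 < N) (u : Fin N → Fin (T + 1) → Fin K)
    (hu : ∀ n, IsHistory (u n)) :
    ∃ c : Code N K T, c.errorProb = 0 ∧ ∀ t, natEntropy (fun _ => 1) (fun n => u n t.succ)
      (fun n => u n t.castSucc) - (K * K : ℕ) * (Real.log (N + 1) + 1) ≤
        Real.log (6 * N * K) + Real.log (c.size t) := by
  classical
  let x : Fin (T + 1) → Block N K := fun t n => u n t
  let S : Fin (T + 1) → Finset (Block N K) := fun t =>
    Finset.univ.image fun σ : Equiv.Perm (Fin N) => x t ∘ σ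
  let V : Fin T → Block N K → Finset (Block N K) := fun t z => (S t.succ).filter fun y => y ≤ z
  let E : Fin T → ℝ := fun t => natEntropy (fun _ => 1) (x t.succ) (x t.castSucc) -
    (K * K : ℕ) * (Real.log (N + 1) + 1)
  have hV : ∀ t, ∀ z ∈ S t.castSucc, ⌈Real.exp (E t)⌉₊ ≤ (V t z).card := by
    intro t z hz
    obtain ⟨σ, -, rfl⟩ := Finset.mem_image.1 hz
    have h1 := exp_natEntropy_le_card (x t.castSucc) (x t.succ) σ
    rw [Fintype.card_prod, Fintype.card_fin, Fintype.card_fin] at h1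
    refine Nat.ceil_le.2 (h1.trans ?_)
    refine Nat.cast_le.2 (Finset.card_le_card fun y hy => ?_)
    obtain ⟨τ, hτ, rfl⟩ := Finset.mem_image.1 hy
    refine Finset.mem_filter.2 ⟨Finset.mem_image_of_mem _ (Finset.mem_univ τ), ?_⟩
    rw [← (Finset.mem_filter.1 hτ).2]
    exact fun n => (hu (τ n)).2 t
  have hcol := fun t => exists_colouring_blocks hN (S t.castSucc) (V t)
    (Nat.ceil_pos.2 (Real.exp_pos (E t))) (hV t)
  choose size hsize hle g hg using hcol
  have h0 : (fun _ => topLevel K) ∈ S 0 :=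
    Finset.mem_image.2 ⟨1, Finset.mem_univ _, funext fun n => (hu n).1⟩
  obtain ⟨c, hc, herr⟩ := exists_code_of_colouring (fun t => (S t : Set (Block N K))) h0 size hsize
    g fun t z hz m => by
      obtain ⟨y, hy, hym⟩ := hg t z hz m
      exact ⟨y, (Finset.mem_filter.1 hy).1, (Finset.mem_filter.1 hy).2, hym⟩
  refine ⟨c, herr, fun t => ?_⟩
  have hNr : (0 : ℝ) < N := by exact_mod_cast hN
  have hKr : (0 : ℝ) < K := by exact_mod_cast NeZero.pos K
  have hs : (0 : ℝ) < c.size t := by exact_mod_cast c.size_pos t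
  rw [← Real.log_mul (by positivity) hs.ne', Real.le_log_iff_exp_le (by positivity), hc]
  refine (Nat.le_ceil (Real.exp (E t))).trans ?_
  exact_mod_cast hle t

end ZeroError

/-! ### Sequences with a prescribed empirical distribution -/

section Empirical

open Topology

/-- Every probability vector on a finite set is the limit of empirical distributions of sequences
in its support: the counts are `⌊N ρ p⌋`, and one letter of the support takes the remainder. -/
theorem exists_empirical {A : Type*} [Fintype A] [DecidableEq A] {ρ : A → ℝ}
    (hρ : ρ ∈ stdSimplex ℝ A) :
    ∃ u : ∀ N, Fin N → A, (∀ N n, ρ (u N n) ≠ 0) ∧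
      ∀ p, Tendsto (fun N : ℕ => (N : ℝ)⁻¹ * marginal (fun _ => 1) (u N) p) atTop (𝓝 (ρ p)) := by
  obtain ⟨h0, h1⟩ := hρ
  obtain ⟨p₀, -, hp₀⟩ : ∃ p ∈ (Finset.univ : Finset A), ρ p ≠ 0 :=
    Finset.exists_ne_zero_of_sum_ne_zero (h1.trans_ne one_ne_zero)
  have hfloor : ∀ N : ℕ, ∑ p, ⌊N * ρ p⌋₊ ≤ N := by
    intro N
    have : ∑ p, (⌊N * ρ p⌋₊ : ℝ) ≤ ∑ p, N * ρ p :=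
      Finset.sum_le_sum fun p _ => Nat.floor_le (mul_nonneg N.cast_nonneg (h0 p))
    rw [← Finset.mul_sum, h1, mul_one] at this
    exact_mod_cast this
  let k : ℕ → A → ℕ := fun N p =>
    ⌊N * ρ p⌋₊ + if p = p₀ then N - ∑ q, ⌊N * ρ q⌋₊ else 0
  have hk : ∀ N, ∑ p, k N p = N := by
    intro N
    simp only [k, Finset.sum_add_distrib, Finset.sum_ite_eq', Finset.mem_univ, if_true]
    exact Nat.add_sub_of_le (hfloor N)
  have hcard : ∀ N, Fintype.card (Σ p, Fin (k N p)) = Fintype.card (Fin N) := by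
    intro N
    simp [hk]
  let e := fun N => (Fintype.equivOfCardEq (hcard N)).symm
  have hcount : ∀ N p, marginal (fun _ => 1) (fun n => (e N n).1) p = (k N p : ℝ) := by
    intro N p
    rw [marginal_one]
    congr 1
    rw [← Fintype.card_subtype, ← Fintype.card_fin (k N p)]
    refine Fintype.card_congr (((e N).subtypeEquiv fun n => Iff.rfl).trans
      (Equiv.sigmaSubtype p))
  refine ⟨fun N n => (e N n).1, fun N n hn => ?_, fun p => ?_⟩
  · have hpos := (e N n).2.pos
    simp only [k, hn, mul_zero, Nat.floor_zero, zero_add] at hpos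
    split_ifs at hpos with h
    · exact hp₀ (h ▸ hn)
    · exact lt_irrefl _ hpos
  · simp only [hcount]
    have hlow : ∀ N : ℕ, N * ρ p - 1 ≤ k N p := by
      intro N
      have := (Nat.lt_floor_add_one (N * ρ p)).le
      have h2 : ((⌊N * ρ p⌋₊ : ℕ) : ℝ) ≤ k N p := by
        exact_mod_cast Nat.le_add_right _ _
      linarith
    have hup : ∀ N : ℕ, (k N p : ℝ) ≤ N * ρ p + Fintype.card A := by
      intro N
      have h2 := Nat.floor_le (mul_nonneg (N.cast_nonneg (α := ℝ)) (h0 p))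
      have h3 : (k N p : ℝ) ≤ ⌊N * ρ p⌋₊ + ((N - ∑ q, ⌊N * ρ q⌋₊ : ℕ) : ℝ) := by
        have : k N p ≤ ⌊N * ρ p⌋₊ + (N - ∑ q, ⌊N * ρ q⌋₊) := by
          simp only [k]
          split_ifs <;> simp
        exact_mod_cast this
      have h4 : ∑ q, (N * ρ q - 1) ≤ ∑ q, (⌊N * ρ q⌋₊ : ℝ) :=
        Finset.sum_le_sum fun q _ => by linarith [Nat.lt_floor_add_one (N * ρ q)]
      rw [Finset.sum_sub_distrib, ← Finset.mul_sum, h1] at h4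
      simp only [Finset.sum_const, nsmul_eq_mul, Finset.card_univ, mul_one] at h4
      rw [Nat.cast_sub (hfloor N)] at h3
      push_cast at h3
      linarith
    have hinv : Tendsto (fun N : ℕ => (N : ℝ)⁻¹) atTop (𝓝 0) := tendsto_inv_atTop_nhds_zero_nat
    have hl : Tendsto (fun N : ℕ => ρ p - (N : ℝ)⁻¹) atTop (𝓝 (ρ p)) := by
      simpa using tendsto_const_nhds.sub hinv
    have hr : Tendsto (fun N : ℕ => ρ p + (N : ℝ)⁻¹ * Fintype.card A) atTop (𝓝 (ρ p)) := by
      simpa using tendsto_const_nhds.add (hinv.mul_const _)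
    refine tendsto_of_tendsto_of_tendsto_of_le_of_le' hl hr ?_ ?_
    · filter_upwards [eventually_gt_atTop 0] with N hN
      have hN' : (0 : ℝ) < N := by exact_mod_cast hN
      rw [le_inv_mul_iff₀ hN', mul_sub, mul_inv_cancel₀ hN'.ne']
      exact hlow N
    · filter_upwards [eventually_gt_atTop 0] with N hN
      have hN' : (0 : ℝ) < N := by exact_mod_cast hN
      rw [inv_mul_le_iff₀ hN', mul_add, mul_inv_cancel_left₀ hN'.ne']
      exact hup N

/-- The polynomial factors do not affect the rates. -/
theorem tendsto_log_overhead (a b : ℝ) :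
    Tendsto (fun N : ℕ => (N : ℝ)⁻¹ * (a * (Real.log (N + 1) + 1) + b)) atTop (𝓝 0) := by
  have hinv : Tendsto (fun N : ℕ => (N : ℝ)⁻¹) atTop (𝓝 0) := tendsto_inv_atTop_nhds_zero_nat
  have hlog : Tendsto (fun N : ℕ => (N : ℝ)⁻¹ * Real.log (N + 1)) atTop (𝓝 0) := by
    have h1 : Tendsto (fun N : ℕ => Real.log (((N + 1 : ℕ) : ℝ)) / ((N + 1 : ℕ) : ℝ)) atTop
        (𝓝 0) := by
      have := (Real.isLittleO_log_id_atTop.tendsto_div_nhds_zero).comp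
        (tendsto_natCast_atTop_atTop.comp (tendsto_add_atTop_nat 1))
      exact this
    have h2 : Tendsto (fun N : ℕ => 1 + (N : ℝ)⁻¹) atTop (𝓝 (1 + 0)) :=
      tendsto_const_nhds.add hinv
    have h3 := h1.mul h2
    rw [zero_mul] at h3
    refine h3.congr' ?_
    filter_upwards [eventually_gt_atTop 0] with N hN
    have hN' : (N : ℝ) ≠ 0 := by exact_mod_cast hN.ne'
    push_cast
    field_simp
  have := (hlog.const_mul a).add (hinv.const_mul (a + b))
  simp only [mul_zero, add_zero] at this
  refine this.congr fun N => ?_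
  ring

end Empirical

/-! ### The rate region -/

section Achievability

open Topology

variable {K T : ℕ} [NeZero K]

theorem roundEntropy_empirical {N K T : ℕ} (u : Fin N → Fin (T + 1) → Fin K) (t : Fin T) :
    roundEntropy (fun p => (N : ℝ)⁻¹ * marginal (fun _ => 1) u p) t =
      (N : ℝ)⁻¹ * natEntropy (fun _ => 1) (fun n => u n t.succ) (fun n => u n t.castSucc) := by
  rw [roundEntropy, natEntropy_const_mul]
  congr 1
  exact natEntropy_marginal (fun _ => 1) u (fun p => p t.succ) fun p => p t.castSucc

theorem achievable_of_historyLaw {l : Fin T → ℝ} {ρ : (Fin (T + 1) → Fin K) → ℝ}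
    (hρ : ρ ∈ historyLaws K T) (hl : ∀ t, l t * Real.log 2 ≤ roundEntropy ρ t) :
    Achievable K T l := by
  intro ε hε
  obtain ⟨u, hu, hlim⟩ := exists_empirical hρ.1
  have hhist : ∀ N n, IsHistory (u N n) := fun N n => by
    -- The law vanishes off the histories, so a letter of its support is one.
    by_contra h
    exact hu N n (hρ.2 _ h)
  have hlog2 : 0 < Real.log 2 := Real.log_pos one_lt_two
  let ν : ℕ → (Fin (T + 1) → Fin K) → ℝ := fun N p => (N : ℝ)⁻¹ * marginal (fun _ => 1) (u N) p
  have hν : Tendsto ν atTop (𝓝 ρ) := tendsto_pi_nhds.2 hlim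
  have hrate : ∀ t, Tendsto (fun N : ℕ => roundEntropy (ν N) t -
      (N : ℝ)⁻¹ * ((K * K + 1 : ℝ) * (Real.log (N + 1) + 1) + Real.log (6 * K))) atTop
      (𝓝 (roundEntropy ρ t)) := fun t => by
    simpa using (((continuous_roundEntropy t).tendsto ρ).comp hν).sub (tendsto_log_overhead _ _)
  have hev : ∀ᶠ N : ℕ in atTop, ∀ t, (l t - ε) * Real.log 2 < roundEntropy (ν N) t -
      (N : ℝ)⁻¹ * ((K * K + 1 : ℝ) * (Real.log (N + 1) + 1) + Real.log (6 * K)) :=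
    eventually_all.2 fun t => (hrate t).eventually (lt_mem_nhds (by nlinarith [hl t]))
  filter_upwards [hev, eventually_gt_atTop 0] with N hN hN0
  obtain ⟨c, herr, hc⟩ := exists_code_of_histories hN0 (u N) (hhist N)
  refine ⟨c, herr.trans_le hε.le, fun t => ?_⟩
  have hN' : (0 : ℝ) < N := by exact_mod_cast hN0
  have hK' : (0 : ℝ) < K := by exact_mod_cast NeZero.pos K
  have hent : natEntropy (fun _ => 1) (fun n => u N n t.succ) (fun n => u N n t.castSucc) =
      N * roundEntropy (ν N) t := by
    rw [roundEntropy_empirical, mul_inv_cancel_left₀ hN'.ne']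
  have h1 := hc t
  have h2 := mul_lt_mul_of_pos_left (hN t) hN'
  rw [mul_sub, mul_inv_cancel_left₀ hN'.ne'] at h2
  have h3 : Real.log (6 * N * K) = Real.log N + Real.log (6 * K) := by
    rw [← Real.log_mul hN'.ne' (by positivity)]
    ring_nf
  have h4 : Real.log N ≤ Real.log (N + 1) := Real.log_le_log hN' (by linarith)
  rw [Code.rate, Real.logb, div_div, le_div_iff₀ (by positivity)]
  rw [hent, h3] at h1
  push_cast at h1
  linarith

end Achievability

end Flash

end

theorem theorem1 (K T : ℕ) [NeZero K] (l : Fin T → ℝ) :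
    Flash.Achievable K T l ↔
      ∃ (Ω : Type) (_ : MeasurableSpace Ω) (P : Measure Ω) (U : Fin (T + 1) → Ω → Fin K),
        IsProbabilityMeasure P ∧ (∀ t, Measurable (U t)) ∧
        (∀ᵐ ω ∂P, U 0 ω = Flash.topLevel K) ∧
        (∀ t : Fin T, ∀ᵐ ω ∂P, U t.succ ω ≤ U t.castSucc ω) ∧
        (∀ t : Fin T, t.val = 0 → l t ≤ Flash.entropy P (U t.succ)) ∧
        (∀ t : Fin T, t.val ≠ 0 → l t ≤ Flash.condEntropy P (U t.succ) (U t.castSucc)) := by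
  rw [Flash.exists_randomVariables_iff]
  exact ⟨Flash.exists_historyLaw_of_achievable,
    fun ⟨_, hρ, hl⟩ => Flash.achievable_of_historyLaw hρ hl⟩
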